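/- Let $d\ge 1$, $\alpha\in(0,2)$, $\beta\in(0,\infty)$, let $\sigma$ be a finite positive Borel measure on the unit sphere $S^{d-1}\subset\mathbb{R}^d$, and let $q:(0,\infty)\times S^{d-1}\to[0,\infty)$ be measurable. Let $c_1,c_2$ be $\sigma$-integrable functions on $S^{d-1}$ such that, for each $\xi\in S^{d-1}$, \[ q(r,\xi)\sim c_1(\xi)r^{-\alpha-1}\ (r\to0),\qquad q(r,\xi)\sim c_2(\xi)r^{-\beta-1}\ (r\to\infty), \] where $f\sim g$ means $f-g=o(g)$ (so $f/g\to1$ if $g$ does not vanish, while $f$ is eventually $0$ if $g\equiv0$); necessarily $c_1,c_2\ge0$. Assume that the second relation holds uniformly in $\xi$: for every $\varepsilon>0$ there is $R>0$ with $|q(r,\xi)-c_2(\xi)r^{-\beta-1}|\le\varepsilon c_2(\xi)r^{-\beta-1}$ for all $r\ge R$ and all $\xi\in S^{d-1}$. Let $\mu$ be a layered stable distribution with these data, that is, an infinitely divisible probability measure on $\mathbb{R}^d$ without Gaussian component whose Lévy measure is \[ \nu(B)=\int_{S^{d-1}}\sigma(d\xi)\int_0^\infty \mathbf 1_B(r\xi)\,q(r,\xi)\,dr,\qquad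 B\in\mathcal B(\mathbb{R}^d\setminus\{0\}), \] and put $\sigma_2(B)=\int_B c_2(\xi)\,\sigma(d\xi)$ for Borel $B\subset S^{d-1}$. (i) If $\sigma_2(S^{d-1})\ne0$, then $\int_{\mathbb{R}^d}\|x\|^p\mu(dx)<\infty$ for every $p\in(0,\beta)$ and $\int_{\mathbb{R}^d}\|x\|^p\mu(dx)=\infty$ for every $p\in[\beta,\infty)$. (ii) For each $p\ge\beta$, $\int_{\mathbb{R}^d}\|x\|^p\mu(dx)<\infty$ if and only if $\sigma_2(S^{d-1})=0$; and for each $\theta>0$, $\int_{\mathbb{R}^d}e^{\theta\|x\|}\mu(dx)<\infty$ if and only if $\sigma_2(S^{d-1})=0$. -/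

import Mathlib

namespace LayeredStable

open MeasureTheory

/-- `ℝ^d` with its Euclidean norm. -/
abbrev Space (d : ℕ) : Type := EuclideanSpace ℝ (Fin d)

/-- The unit sphere `S^{d-1}` of `ℝ^d`, with its Borel σ-algebra. -/
abbrev UnitSphere (d : ℕ) : Type := Metric.sphere (0 : Space d) 1

/-- The `n`-fold convolution of a measure with itself. -/
noncomputable def convPow {d : ℕ} (ρ : Measure (Space d)) : ℕ → Measure (Space d)
  | 0 => Measure.dirac 0
  | n + 1 => Measure.conv (convPow ρ n) ρ

/-- Infinitely divisible probability measures: for every `n ≥ 1` there is a convolution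
`n`-th root which is a probability measure. -/
def IsInfinitelyDivisible {d : ℕ} (μ : Measure (Space d)) : Prop :=
  IsProbabilityMeasure μ ∧
    ∀ n : ℕ, 1 ≤ n → ∃ ρ : Measure (Space d), IsProbabilityMeasure ρ ∧ convPow ρ n = μ

/-- Lévy measures on `ℝ^d ∖ {0}`, regarded as measures on `ℝ^d` that do not charge `0`. -/
def IsLevyMeasure {d : ℕ} (ν : Measure (Space d)) : Prop :=
  ν {0} = 0 ∧ ∫⁻ z, ENNReal.ofReal (min 1 (‖z‖ ^ 2)) ∂ν < ⊤

/-- The integrand `e^{i⟨y,z⟩} - 1 - i⟨y,z⟩ 1_{‖z‖ ≤ 1}` of the Lévy–Khintchine formula. -/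
noncomputable def levyKhintchineIntegrand {d : ℕ} (y z : Space d) : ℂ :=
  Complex.exp (Complex.I * (inner ℝ y z : ℝ)) - 1
    - Complex.I * (inner ℝ y z : ℝ) * (if ‖z‖ ≤ 1 then 1 else 0)

/-- `μ` is infinitely divisible, without Gaussian component, and `ν` is its Lévy measure
(generating triplet `(η, 0, ν)` for some `η`). -/
def IsPurelyNonGaussianWith {d : ℕ} (μ ν : Measure (Space d)) : Prop :=
  IsInfinitelyDivisible μ ∧ IsLevyMeasure ν ∧
    ∃ η : Space d, ∀ y : Space d,
      charFun μ y =
        Complex.exp (Complex.I * (inner ℝ y η : ℝ) + ∫ z, levyKhintchineIntegrand y z ∂ν)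

/-- `ν(B) = ∫_{S^{d-1}} σ(dξ) ∫_0^∞ 1_B(rξ) q(r,ξ) dr` for all Borel sets `B`
(in particular `ν {0} = 0`). Only the values of `q` at `r > 0` matter. -/
def HasPolarForm {d : ℕ} (ν : Measure (Space d)) (σ : Measure (UnitSphere d))
    (q : ℝ → UnitSphere d → ℝ) : Prop :=
  ∀ B : Set (Space d), MeasurableSet B →
    ν B = ∫⁻ ξ, (∫⁻ r in Set.Ioi (0 : ℝ),
      B.indicator (fun _ => ENNReal.ofReal (q r ξ)) (r • (ξ : Space d))) ∂σ

/-- `μ` is a layered stable distribution with inner index `α`, outer index `β`, Lévy measure `ν`,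
spherical measure `σ`, `q`-function `q` and asymptotic coefficients `c₁`, `c₂`.

The relation `∼` is Mathlib's `Asymptotics.IsEquivalent` (that is, `f - g = o(g)`). Where `g` does
not vanish it says `f / g → 1`; where `g` is zero it says that `f` is eventually zero. The
`q`-function is allowed to take the value `0`, so that `c₂` may vanish; a strictly positive `q` is
a special case, and forces `c₁, c₂ > 0`. In all cases `c₁, c₂ ≥ 0`. -/
structure IsLayeredStable {d : ℕ} (α β : ℝ) (σ : Measure (UnitSphere d))
    (q : ℝ → UnitSphere d → ℝ) (c₁ c₂ : UnitSphere d → ℝ) (ν μ : Measure (Space d)) : Prop where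
  inner_pos : 0 < α
  inner_lt_two : α < 2
  outer_pos : 0 < β
  finite_spherical : IsFiniteMeasure σ
  measurable_q : Measurable (Function.uncurry q)
  q_nonneg : ∀ r : ℝ, 0 < r → ∀ ξ, 0 ≤ q r ξ
  integrable_c₁ : Integrable c₁ σ
  integrable_c₂ : Integrable c₂ σ
  short_q : ∀ ξ, Asymptotics.IsEquivalent (nhdsWithin (0 : ℝ) (Set.Ioi 0))
    (fun r => q r ξ) (fun r => c₁ ξ * r ^ (-α - 1))
  long_q : ∀ ξ, Asymptotics.IsEquivalent Filter.atTop
    (fun r => q r ξ) (fun r => c₂ ξ * r ^ (-β - 1))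
  polar : HasPolarForm ν σ q
  law : IsPurelyNonGaussianWith μ ν

/-- The asymptotics `q(r,ξ) ∼ c₂(ξ) r^{-β-1}` as `r → ∞` hold uniformly in the direction `ξ`. -/
def LongUniform {d : ℕ} (β : ℝ) (q : ℝ → UnitSphere d → ℝ) (c₂ : UnitSphere d → ℝ) : Prop :=
  ∀ ε : ℝ, 0 < ε → ∃ R : ℝ, 0 < R ∧ ∀ ξ, ∀ r : ℝ, R ≤ r →
    |q r ξ - c₂ ξ * r ^ (-β - 1)| ≤ ε * (c₂ ξ * r ^ (-β - 1))

/-- The measure `σ₂(B) = ∫_B c₂(ξ) σ(dξ)` on the sphere. -/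
noncomputable def sphericalWithDensity {d : ℕ} (σ : Measure (UnitSphere d))
    (c₂ : UnitSphere d → ℝ) : Measure (UnitSphere d) :=
  σ.withDensity (fun ξ => ENNReal.ofReal (c₂ ξ))

/-- The absolute moment `∫ ‖x‖^p μ(dx) ∈ [0, ∞]`. -/
noncomputable def absMoment {d : ℕ} (μ : Measure (Space d)) (p : ℝ) : ENNReal :=
  ∫⁻ x, ENNReal.ofReal (‖x‖ ^ p) ∂μ

/-- The exponential moment `∫ e^{θ‖x‖} μ(dx) ∈ [0, ∞]`. -/
noncomputable def expMoment {d : ℕ} (μ : Measure (Space d)) (θ : ℝ) : ENNReal :=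
  ∫⁻ x, ENNReal.ofReal (Real.exp (θ * ‖x‖)) ∂μ

end LayeredStable

namespace LayeredStable

open MeasureTheory Filter Topology
open scoped ENNReal

variable {d : ℕ}

/-! ### Compound Poisson measures -/

/-! Finiteness of a moment of `μ` is decided by the large jumps of `ν`. Discard the jumps of size at
most 1/(n+1). What remains is the convolution of a centered compound Poisson law (`smallPart`) with
a shifted compound Poisson law of the jumps larger than 1 (`largePart`), and these convolutions
converge weakly to `μ`.

The small parts have exponential moments bounded uniformly in n: centering turns the log-Laplace
transform into an integral of e^s - 1 - s with s = ⟨y,z⟩, which is controlled by the integral of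
min(1, ‖z‖²) against `ν`. Submultiplicative moments of the large part are bounded by summing the
exponential series. A Fatou-type inequality then gives the upper transfer
(`lintegral_lt_top_of_submultiplicative`). Conversely, if exactly one large jump occurs and the
small part stays bounded, the sum is large, so tails of `μ` dominate shifted tails of `ν`
(`exists_mul_measure_le`).

In polar coordinates the uniform asymptotics make ν{‖z‖ ≥ s} at least a constant times σ₂(S) s^(-β),
and make ‖z‖^p integrable at infinity for p < β. If σ₂ vanishes, the same uniformity bounds the
support of `ν`, and all exponential moments are finite. -/

instance isFiniteMeasure_convPow (ρ : Measure (Space d)) [IsFiniteMeasure ρ] (k : ℕ) :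
    IsFiniteMeasure (convPow ρ k) := by
  induction k with
  | zero => rw [convPow]; infer_instance
  | succ k ih => rw [convPow]; infer_instance

theorem convPow_one (ρ : Measure (Space d)) [IsFiniteMeasure ρ] : convPow ρ 1 = ρ := by
  rw [convPow, convPow, Measure.dirac_zero_conv]

/-- Submultiplicativity factors the double integral of a convolution; `h0` is what the Dirac mass at
k = 0 needs. -/
theorem lintegral_convPow_le (ρ : Measure (Space d)) [IsFiniteMeasure ρ] {g : Space d → ℝ≥0∞}
    (hg : Measurable g) (h0 : g 0 ≤ 1) (hmul : ∀ x y, g (x + y) ≤ g x * g y) (k : ℕ) :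
    ∫⁻ x, g x ∂(convPow ρ k) ≤ (∫⁻ x, g x ∂ρ) ^ k := by
  induction k with
  | zero => rw [convPow, lintegral_dirac' _ hg, pow_zero]; exact h0
  | succ k ih =>
    rw [convPow, Measure.lintegral_conv hg, pow_succ]
    calc ∫⁻ x, ∫⁻ y, g (x + y) ∂ρ ∂(convPow ρ k)
        ≤ ∫⁻ x, ∫⁻ y, g x * g y ∂ρ ∂(convPow ρ k) :=
          lintegral_mono fun x => lintegral_mono fun y => hmul x y
      _ = (∫⁻ x, g x ∂(convPow ρ k)) * ∫⁻ y, g y ∂ρ := by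
          simp_rw [lintegral_const_mul _ hg]
          rw [lintegral_mul_const _ hg]
      _ ≤ _ := by gcongr

theorem charFun_convPow (ρ : Measure (Space d)) [IsFiniteMeasure ρ] (k : ℕ) (t : Space d) :
    charFun (convPow ρ k) t = charFun ρ t ^ k := by
  induction k with
  | zero => simp [convPow]
  | succ k ih => rw [convPow, charFun_conv, ih, pow_succ]

/-- The compound Poisson distribution with (finite) jump measure `ρ`. -/
noncomputable def compoundPoisson (ρ : Measure (Space d)) : Measure (Space d) :=
  Measure.sum fun k : ℕ =>
    ENNReal.ofReal (Real.exp (-ρ.real Set.univ) * ((k.factorial : ℝ)⁻¹)) • convPow ρ k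

/-- Sum the previous bound against the Poisson weights. The total mass stays in the exponent: for
small jumps it may blow up as the truncation is removed, and must cancel against m. -/
theorem lintegral_compoundPoisson_le (ρ : Measure (Space d)) [IsFiniteMeasure ρ]
    {g : Space d → ℝ≥0∞} (hg : Measurable g) (h0 : g 0 ≤ 1)
    (hmul : ∀ x y, g (x + y) ≤ g x * g y) {m : ℝ} (hm : 0 ≤ m)
    (hρ : ∫⁻ x, g x ∂ρ ≤ ENNReal.ofReal m) :
    ∫⁻ x, g x ∂(compoundPoisson ρ) ≤ ENNReal.ofReal (Real.exp (m - ρ.real Set.univ)) := by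
  have hs : HasSum (fun k : ℕ => Real.exp (-ρ.real Set.univ) * ((k.factorial : ℝ)⁻¹ * m ^ k))
      (Real.exp (-ρ.real Set.univ) * Real.exp m) := by
    refine HasSum.mul_left _ ?_
    have := NormedSpace.exp_series_hasSum_exp' (𝕂 := ℝ) m
    rw [← Real.exp_eq_exp_ℝ] at this
    simpa using this
  rw [compoundPoisson, lintegral_sum_measure]
  calc ∑' k : ℕ, ∫⁻ x, g x ∂(ENNReal.ofReal
          (Real.exp (-ρ.real Set.univ) * ((k.factorial : ℝ)⁻¹)) • convPow ρ k)
      ≤ ∑' k : ℕ, ENNReal.ofReal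
          (Real.exp (-ρ.real Set.univ) * ((k.factorial : ℝ)⁻¹ * m ^ k)) := by
        refine ENNReal.tsum_le_tsum fun k => ?_
        rw [lintegral_smul_measure, smul_eq_mul, ← mul_assoc,
          ENNReal.ofReal_mul (q := m ^ k) (by positivity), ENNReal.ofReal_pow hm]
        gcongr
        exact (lintegral_convPow_le ρ hg h0 hmul k).trans (by gcongr)
    _ = ENNReal.ofReal (Real.exp (m - ρ.real Set.univ)) := by
        rw [← ENNReal.ofReal_tsum_of_nonneg (fun k => by positivity) hs.summable, hs.tsum_eq,
          ← Real.exp_add, neg_add_eq_sub]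

theorem isFiniteMeasure_compoundPoisson (ρ : Measure (Space d)) [IsFiniteMeasure ρ] :
    IsFiniteMeasure (compoundPoisson ρ) := by
  constructor
  have := lintegral_compoundPoisson_le ρ (g := fun _ => 1) measurable_const le_rfl
    (by simp) (m := ρ.real Set.univ) measureReal_nonneg (by simp)
  simpa using this.trans_lt ENNReal.ofReal_lt_top

theorem charFun_compoundPoisson (ρ : Measure (Space d)) [IsFiniteMeasure ρ] (t : Space d) :
    charFun (compoundPoisson ρ) t = Complex.exp (charFun ρ t - ρ.real Set.univ) := by
  have := isFiniteMeasure_compoundPoisson ρ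
  have hi : Integrable (fun x : Space d => Complex.exp ((inner ℝ x t : ℝ) * Complex.I))
      (compoundPoisson ρ) :=
    (integrable_const (1 : ℝ)).mono (by fun_prop) (by simp)
  have h1 := hasSum_integral_measure hi
  have hs : HasSum (fun k : ℕ => Complex.exp (-ρ.real Set.univ : ℝ)
        * ((k.factorial : ℂ)⁻¹ * charFun ρ t ^ k))
      (Complex.exp (-ρ.real Set.univ : ℝ) * Complex.exp (charFun ρ t)) := by
    refine HasSum.mul_left _ ?_
    have := NormedSpace.exp_series_hasSum_exp' (𝕂 := ℂ) (charFun ρ t)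
    rw [← Complex.exp_eq_exp_ℂ] at this
    simpa using this
  rw [charFun_apply]
  refine (h1.unique ?_).trans
    (b := Complex.exp (-ρ.real Set.univ : ℝ) * Complex.exp (charFun ρ t)) ?_
  · convert! hs using 2 with k
    rw [integral_smul_measure, ← charFun_apply, charFun_convPow,
      ENNReal.toReal_ofReal (by positivity), Complex.real_smul]
    push_cast
    ring
  · rw [← Complex.exp_add]
    congr 1
    push_cast
    ring

instance isProbabilityMeasure_compoundPoisson (ρ : Measure (Space d)) [IsFiniteMeasure ρ] :
    IsProbabilityMeasure (compoundPoisson ρ) := by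
  have := isFiniteMeasure_compoundPoisson ρ
  have h := charFun_compoundPoisson ρ 0
  rw [charFun_zero, charFun_zero, sub_self, Complex.exp_zero] at h
  have h1 : (compoundPoisson ρ).real Set.univ = 1 := by exact_mod_cast h
  constructor
  rw [← ENNReal.toReal_eq_one_iff]
  exact h1

/-- Keep only the k = 1 term of the series, the event of exactly one jump. -/
theorem smul_le_compoundPoisson (ρ : Measure (Space d)) [IsFiniteMeasure ρ] :
    ENNReal.ofReal (Real.exp (-ρ.real Set.univ)) • ρ ≤ compoundPoisson ρ := by
  have := Measure.le_sum (fun k : ℕ =>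
    ENNReal.ofReal (Real.exp (-ρ.real Set.univ) * ((k.factorial : ℝ)⁻¹)) • convPow ρ k) 1
  simpa [convPow_one, compoundPoisson] using this

/-! ### The Lévy–Khintchine integrand -/

theorem measurable_levyKhintchineIntegrand (y : Space d) :
    Measurable (levyKhintchineIntegrand y) := by
  unfold levyKhintchineIntegrand
  refine Measurable.sub (by fun_prop) (Measurable.mul (by fun_prop) ?_)
  exact Measurable.ite (measurableSet_le (by fun_prop) (by fun_prop)) (by fun_prop) (by fun_prop)

/-- Second-order Taylor estimate inside the unit ball, the trivial bound 2 outside; the constant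
adds those of the two cases. -/
theorem norm_levyKhintchineIntegrand_le (y z : Space d) :
    ‖levyKhintchineIntegrand y z‖ ≤ (2 + ‖y‖ ^ 2 * Real.exp ‖y‖) * min 1 (‖z‖ ^ 2) := by
  unfold levyKhintchineIntegrand
  have hin : |inner ℝ y z| ≤ ‖y‖ * ‖z‖ := abs_real_inner_le_norm y z
  by_cases hz : ‖z‖ ≤ 1
  · have h := Complex.norm_exp_sub_sum_le_norm_mul_exp (Complex.I * (inner ℝ y z : ℝ)) 2
    simp only [Finset.sum_range_succ, Finset.range_zero, Finset.sum_empty, pow_zero, pow_one,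
      Nat.factorial, zero_add, Nat.cast_one, div_one, mul_one, norm_mul, Complex.norm_I, one_mul,
      Complex.norm_real, Real.norm_eq_abs, ← sub_sub] at h
    rw [if_pos hz, mul_one, min_eq_right (by nlinarith [norm_nonneg z])]
    refine h.trans ?_
    have h1 : |inner ℝ y z| ^ 2 ≤ (‖y‖ * ‖z‖) ^ 2 := by gcongr
    have h2 : Real.exp |inner ℝ y z| ≤ Real.exp ‖y‖ :=
      Real.exp_le_exp.2 (hin.trans (mul_le_of_le_one_right (norm_nonneg y) hz))
    calc |inner ℝ y z| ^ 2 * Real.exp |inner ℝ y z|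
        ≤ (‖y‖ * ‖z‖) ^ 2 * Real.exp ‖y‖ := by gcongr
      _ ≤ _ := by nlinarith [sq_nonneg ‖z‖]
  · rw [if_neg hz, mul_zero, sub_zero, min_eq_left (by nlinarith), mul_one]
    have h1 : ‖Complex.exp (Complex.I * (inner ℝ y z : ℝ)) - 1‖ ≤ 1 + 1 := by
      refine (norm_sub_le _ _).trans ?_
      rw [mul_comm, Complex.norm_exp_ofReal_mul_I, norm_one]
    have : 0 ≤ ‖y‖ ^ 2 * Real.exp ‖y‖ := by positivity
    linarith

theorem IsLevyMeasure.integrable_min {ν : Measure (Space d)} (hν : IsLevyMeasure ν) :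
    Integrable (fun z => min 1 (‖z‖ ^ 2)) ν := by
  refine ⟨by fun_prop, ?_⟩
  rw [hasFiniteIntegral_iff_ofReal (Eventually.of_forall fun z => by positivity)]
  exact hν.2

theorem IsLevyMeasure.integrable_levyKhintchineIntegrand {ν : Measure (Space d)}
    (hν : IsLevyMeasure ν) (y : Space d) : Integrable (levyKhintchineIntegrand y) ν :=
  (hν.integrable_min.const_mul (2 + ‖y‖ ^ 2 * Real.exp ‖y‖)).mono'
    (measurable_levyKhintchineIntegrand y).aestronglyMeasurable
    (Eventually.of_forall (norm_levyKhintchineIntegrand_le y))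

theorem IsLevyMeasure.measure_lt_norm_lt_top {ν : Measure (Space d)}
    (hν : IsLevyMeasure ν) {ε : ℝ} (hε : 0 < ε) : ν {z | ε < ‖z‖} < ⊤ := by
  refine lt_of_le_of_lt (measure_mono ?_)
    (hν.integrable_min.measure_ge_lt_top (ε := min 1 (ε ^ 2)) (by positivity))
  intro z hz
  have hz' : ε < ‖z‖ := hz
  exact min_le_min le_rfl (pow_le_pow_left₀ hε.le hz'.le 2)

/-- For a finite measure concentrated on the unit ball, the Lévy–Khintchine integral splits. -/
theorem integral_levyKhintchineIntegrand_of_le_one {ρ : Measure (Space d)} [IsFiniteMeasure ρ]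
    (hρ : ∀ᵐ z ∂ρ, ‖z‖ ≤ 1) (y : Space d) :
    ∫ z, levyKhintchineIntegrand y z ∂ρ
      = charFun ρ y - ρ.real Set.univ - Complex.I * (inner ℝ y (∫ z, z ∂ρ) : ℝ) := by
  have hid : Integrable (fun z : Space d => z) ρ :=
    Integrable.of_bound (by fun_prop) 1 hρ
  have hexp : Integrable (fun z : Space d => Complex.exp (Complex.I * (inner ℝ y z : ℝ))) ρ := by
    refine (integrable_const (1 : ℝ)).mono (by fun_prop) (Eventually.of_forall fun z => ?_)
    rw [mul_comm, Complex.norm_exp_ofReal_mul_I, norm_one]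
  have hin : Integrable (fun z : Space d => inner ℝ y z) ρ := hid.const_inner y
  have hinC : Integrable (fun z : Space d => Complex.I * ((inner ℝ y z : ℝ) : ℂ)) ρ :=
    hin.ofReal.const_mul _
  calc ∫ z, levyKhintchineIntegrand y z ∂ρ
      = ∫ z, (Complex.exp (Complex.I * (inner ℝ y z : ℝ)) - 1
          - Complex.I * (inner ℝ y z : ℝ)) ∂ρ := by
        refine integral_congr_ae ?_
        filter_upwards [hρ] with z hz
        simp [levyKhintchineIntegrand, hz]
    _ = _ := by
        rw [integral_sub (f := fun z => Complex.exp (Complex.I * (inner ℝ y z : ℝ)) - 1)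
            (hexp.sub (integrable_const _)) hinC,
          integral_sub hexp (integrable_const _), integral_const_mul, integral_complex_ofReal,
          integral_inner hid, charFun_apply]
        simp [real_inner_comm, mul_comm]

theorem integral_levyKhintchineIntegrand_of_one_lt {ρ : Measure (Space d)} [IsFiniteMeasure ρ]
    (hρ : ∀ᵐ z ∂ρ, 1 < ‖z‖) (y : Space d) :
    ∫ z, levyKhintchineIntegrand y z ∂ρ = charFun ρ y - ρ.real Set.univ := by
  have hexp : Integrable (fun z : Space d => Complex.exp (Complex.I * (inner ℝ y z : ℝ))) ρ := by
    refine (integrable_const (1 : ℝ)).mono (by fun_prop) (Eventually.of_forall fun z => ?_)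
    rw [mul_comm, Complex.norm_exp_ofReal_mul_I, norm_one]
  calc ∫ z, levyKhintchineIntegrand y z ∂ρ
      = ∫ z, (Complex.exp (Complex.I * (inner ℝ y z : ℝ)) - 1) ∂ρ := by
        refine integral_congr_ae ?_
        filter_upwards [hρ] with z hz
        simp [levyKhintchineIntegrand, not_le.2 hz]
    _ = _ := by
        rw [integral_sub hexp (integrable_const _), charFun_apply]
        simp [real_inner_comm, mul_comm]

/-! ### Approximation by compound Poisson distributions -/

/-- The jumps of `ν` of size in `(1/(n+1), 1]`. -/
noncomputable def smallJumps (ν : Measure (Space d)) (n : ℕ) : Measure (Space d) :=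
  ν.restrict {z | 1 / ((n : ℝ) + 1) < ‖z‖ ∧ ‖z‖ ≤ 1}

/-- The jumps of `ν` of size greater than `1`. -/
noncomputable def largeJumps (ν : Measure (Space d)) : Measure (Space d) :=
  ν.restrict {z | 1 < ‖z‖}

/-- The centered compound Poisson distribution with jump measure `smallJumps ν n`. -/
noncomputable def smallPart (ν : Measure (Space d)) (n : ℕ) : Measure (Space d) :=
  (compoundPoisson (smallJumps ν n)).map (· + -∫ z, z ∂(smallJumps ν n))

/-- The compound Poisson distribution of the large jumps, shifted by `η`. -/
noncomputable def largePart (ν : Measure (Space d)) (η : Space d) : Measure (Space d) :=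
  (compoundPoisson (largeJumps ν)).map (· + η)

/-- The infinitely divisible distribution obtained by discarding the jumps of size at most
`1/(n+1)`. -/
noncomputable def truncatedLaw (ν : Measure (Space d)) (η : Space d) (n : ℕ) :
    Measure (Space d) :=
  Measure.conv (smallPart ν n) (largePart ν η)

theorem measurableSet_smallJumps (n : ℕ) :
    MeasurableSet {z : Space d | 1 / ((n : ℝ) + 1) < ‖z‖ ∧ ‖z‖ ≤ 1} :=
  (measurableSet_lt measurable_const measurable_norm).inter
    (measurableSet_le measurable_norm measurable_const)

theorem measurableSet_largeJumps : MeasurableSet {z : Space d | 1 < ‖z‖} :=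
  measurableSet_lt (by fun_prop) (by fun_prop)

theorem IsLevyMeasure.isFiniteMeasure_smallJumps {ν : Measure (Space d)}
    (hν : IsLevyMeasure ν) (n : ℕ) : IsFiniteMeasure (smallJumps ν n) := by
  constructor
  rw [smallJumps, Measure.restrict_apply_univ]
  exact (measure_mono fun z hz => hz.1).trans_lt
    (hν.measure_lt_norm_lt_top (ε := 1 / ((n : ℝ) + 1)) (by positivity))

theorem IsLevyMeasure.isFiniteMeasure_largeJumps {ν : Measure (Space d)}
    (hν : IsLevyMeasure ν) : IsFiniteMeasure (largeJumps ν) := by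
  constructor
  rw [largeJumps, Measure.restrict_apply_univ]
  exact hν.measure_lt_norm_lt_top one_pos

theorem ae_smallJumps_norm_le (ν : Measure (Space d)) (n : ℕ) :
    ∀ᵐ z ∂(smallJumps ν n), ‖z‖ ≤ 1 := by
  filter_upwards [ae_restrict_mem (measurableSet_smallJumps n)] with z hz using hz.2

theorem ae_largeJumps_one_lt (ν : Measure (Space d)) : ∀ᵐ z ∂(largeJumps ν), 1 < ‖z‖ :=
  ae_restrict_mem measurableSet_largeJumps

theorem IsLevyMeasure.isProbabilityMeasure_smallPart {ν : Measure (Space d)}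
    (hν : IsLevyMeasure ν) (n : ℕ) : IsProbabilityMeasure (smallPart ν n) := by
  have := hν.isFiniteMeasure_smallJumps n
  exact Measure.isProbabilityMeasure_map (by fun_prop)

theorem IsLevyMeasure.isProbabilityMeasure_largePart {ν : Measure (Space d)}
    (hν : IsLevyMeasure ν) (η : Space d) : IsProbabilityMeasure (largePart ν η) := by
  have := hν.isFiniteMeasure_largeJumps
  exact Measure.isProbabilityMeasure_map (by fun_prop)

theorem IsLevyMeasure.isProbabilityMeasure_truncatedLaw {ν : Measure (Space d)}
    (hν : IsLevyMeasure ν) (η : Space d) (n : ℕ) :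
    IsProbabilityMeasure (truncatedLaw ν η n) := by
  have := hν.isProbabilityMeasure_smallPart n
  have := hν.isProbabilityMeasure_largePart η
  rw [truncatedLaw]
  infer_instance

/-- The mean subtracted in `smallPart` is exactly the compensator on the unit ball; jumps larger
than 1 carry none. -/
theorem IsLevyMeasure.charFun_truncatedLaw {ν : Measure (Space d)}
    (hν : IsLevyMeasure ν) (η : Space d) (n : ℕ) (y : Space d) :
    charFun (truncatedLaw ν η n) y = Complex.exp (Complex.I * (inner ℝ y η : ℝ)
      + ∫ z in {z | 1 / ((n : ℝ) + 1) < ‖z‖}, levyKhintchineIntegrand y z ∂ν) := by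
  have := hν.isFiniteMeasure_smallJumps n
  have := hν.isFiniteMeasure_largeJumps
  have := hν.isProbabilityMeasure_smallPart n
  have := hν.isProbabilityMeasure_largePart η
  have hset : {z : Space d | 1 / ((n : ℝ) + 1) < ‖z‖}
      = {z | 1 / ((n : ℝ) + 1) < ‖z‖ ∧ ‖z‖ ≤ 1} ∪ {z | 1 < ‖z‖} := by
    ext z
    have hn : 1 / ((n : ℝ) + 1) ≤ 1 := by
      rw [div_le_one (by positivity)]; linarith [(Nat.cast_nonneg n : (0 : ℝ) ≤ n)]
    simp only [Set.mem_ofPred_eq, Set.mem_union]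
    constructor
    · intro h
      rcases le_or_gt ‖z‖ 1 with h1 | h1
      · exact Or.inl ⟨h, h1⟩
      · exact Or.inr h1
    · rintro (h | h)
      · exact h.1
      · exact hn.trans_lt h
  have hint := hν.integrable_levyKhintchineIntegrand y
  rw [hset, setIntegral_union ?_ measurableSet_largeJumps hint.integrableOn hint.integrableOn,
    ← smallJumps, ← largeJumps,
    integral_levyKhintchineIntegrand_of_le_one (ae_smallJumps_norm_le ν n),
    integral_levyKhintchineIntegrand_of_one_lt (ae_largeJumps_one_lt ν),
    truncatedLaw, charFun_conv, smallPart, largePart, charFun_map_add_const,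
    charFun_map_add_const, charFun_compoundPoisson, charFun_compoundPoisson, ← Complex.exp_add,
    ← Complex.exp_add, ← Complex.exp_add]
  · congr 1
    rw [inner_neg_left, real_inner_comm η y, real_inner_comm y]
    push_cast
    ring
  · rw [Set.disjoint_left]
    intro z hz hz'
    exact absurd hz.2 (not_le.2 hz')

/-- By Lévy's continuity theorem it suffices that the exponents converge. They do because the
integrand is integrable and the truncation sets increase to the complement of 0, which has full
measure. -/
theorem IsPurelyNonGaussianWith.exists_tendsto_truncatedLaw {μ ν : Measure (Space d)}
    (h : IsPurelyNonGaussianWith μ ν) :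
    ∃ η : Space d, ∃ (μs : ℕ → ProbabilityMeasure (Space d)) (μ' : ProbabilityMeasure (Space d)),
      (∀ n, (μs n : Measure (Space d)) = truncatedLaw ν η n) ∧ (μ' : Measure (Space d)) = μ ∧
      Tendsto μs atTop (𝓝 μ') := by
  obtain ⟨⟨hμ, -⟩, hν, η, hη⟩ := h
  refine ⟨η, fun n => ⟨truncatedLaw ν η n, hν.isProbabilityMeasure_truncatedLaw η n⟩, ⟨μ, hμ⟩,
    fun n => rfl, rfl, ProbabilityMeasure.tendsto_of_tendsto_charFun fun y => ?_⟩
  simp only [ProbabilityMeasure.coe_mk, hη, hν.charFun_truncatedLaw]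
  refine (Complex.continuous_exp.tendsto _).comp (Tendsto.const_add _ ?_)
  have hint := hν.integrable_levyKhintchineIntegrand y
  have hmono : Monotone fun n : ℕ => {z : Space d | 1 / ((n : ℝ) + 1) < ‖z‖} := by
    intro m n hmn z hz
    have hmn' : (m : ℝ) ≤ n := by exact_mod_cast hmn
    exact lt_of_le_of_lt (one_div_le_one_div_of_le (by positivity)
      (add_le_add_left hmn' 1)) hz
  have hlim := tendsto_setIntegral_of_monotone (μ := ν) (f := levyKhintchineIntegrand y)
    (s := fun n : ℕ => {z | 1 / ((n : ℝ) + 1) < ‖z‖})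
    (fun n => measurableSet_lt (by fun_prop) (by fun_prop))
    hmono hint.integrableOn
  have hU : (⋃ n : ℕ, {z : Space d | 1 / ((n : ℝ) + 1) < ‖z‖}) = {0}ᶜ := by
    ext z
    simp only [Set.mem_iUnion, Set.mem_ofPred_eq, Set.mem_compl_iff, Set.mem_singleton_iff]
    constructor
    · rintro ⟨n, hn⟩ rfl
      rw [norm_zero] at hn
      exact absurd hn (not_lt.2 (by positivity))
    · intro hz
      exact exists_nat_one_div_lt (norm_pos_iff.2 hz)
  rw [hU] at hlim
  have hae : ({0}ᶜ : Set (Space d)) =ᵐ[ν] Set.univ := by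
    rw [ae_eq_univ, compl_compl]
    exact hν.1
  rwa [setIntegral_congr_set hae, setIntegral_univ] at hlim

/-! ### Exponential moments of the small jumps -/

theorem exp_sub_one_sub_le (s : ℝ) : Real.exp s - 1 - s ≤ s ^ 2 * Real.exp |s| := by
  have h := Complex.norm_exp_sub_sum_le_norm_mul_exp (s : ℂ) 2
  simp only [Finset.sum_range_succ, Finset.range_zero, Finset.sum_empty, pow_zero, pow_one,
    Nat.factorial, zero_add, Nat.cast_one, div_one, mul_one,
    Complex.norm_real, Real.norm_eq_abs, ← sub_sub, sq_abs] at h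
  refine le_trans ?_ h
  have : Complex.exp (s : ℂ) - 1 - s = ((Real.exp s - 1 - s : ℝ) : ℂ) := by push_cast; rfl
  rw [this, Complex.norm_real]
  exact le_abs_self _

/-- The total mass and the mean of the small jumps may both diverge with n, but they enter only
through e^s - 1 - s, which is quadratic near 0. Hence a bound independent of n. -/
theorem IsLevyMeasure.lintegral_exp_inner_smallPart_le {ν : Measure (Space d)}
    (hν : IsLevyMeasure ν) (n : ℕ) (y : Space d) :
    ∫⁻ x, ENNReal.ofReal (Real.exp (inner ℝ y x)) ∂(smallPart ν n)
      ≤ ENNReal.ofReal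
        (Real.exp (‖y‖ ^ 2 * Real.exp ‖y‖ * ∫ z, min 1 (‖z‖ ^ 2) ∂ν)) := by
  have := hν.isFiniteMeasure_smallJumps n
  set ρ := smallJumps ν n with hρ
  have hle : ∀ᵐ z ∂ρ, ‖z‖ ≤ 1 := ae_smallJumps_norm_le ν n
  have hid : Integrable (fun z : Space d => z) ρ := Integrable.of_bound (by fun_prop) 1 hle
  have habs : ∀ᵐ z ∂ρ, |inner ℝ y z| ≤ ‖y‖ := by
    filter_upwards [hle] with z hz
    exact (abs_real_inner_le_norm y z).trans (mul_le_of_le_one_right (norm_nonneg y) hz)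
  have hexp : Integrable (fun z : Space d => Real.exp (inner ℝ y z)) ρ := by
    refine Integrable.of_bound (by fun_prop) (Real.exp ‖y‖) ?_
    filter_upwards [habs] with z hz
    rw [Real.norm_eq_abs, Real.abs_exp]
    exact Real.exp_le_exp.2 ((le_abs_self _).trans hz)
  have hin : Integrable (fun z : Space d => inner ℝ y z) ρ := hid.const_inner y
  have hcp := lintegral_compoundPoisson_le ρ
    (g := fun x => ENNReal.ofReal (Real.exp (inner ℝ y x))) (by fun_prop) (by simp)
    (fun x z => by
      rw [inner_add_right, Real.exp_add, ENNReal.ofReal_mul (Real.exp_pos _).le])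
    (m := ∫ z, Real.exp (inner ℝ y z) ∂ρ) (integral_nonneg fun z => (Real.exp_pos _).le)
    (ofReal_integral_eq_lintegral_ofReal hexp
      (Eventually.of_forall fun z => (Real.exp_pos _).le)).ge
  have hexponent : (∫ z, Real.exp (inner ℝ y z) ∂ρ) - ρ.real Set.univ + -inner ℝ y (∫ z, z ∂ρ)
      ≤ ‖y‖ ^ 2 * Real.exp ‖y‖ * ∫ z, min 1 (‖z‖ ^ 2) ∂ν := by
    calc (∫ z, Real.exp (inner ℝ y z) ∂ρ) - ρ.real Set.univ + -inner ℝ y (∫ z, z ∂ρ)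
        = ∫ z, (Real.exp (inner ℝ y z) - 1 - inner ℝ y z) ∂ρ := by
          rw [integral_sub (f := fun z => Real.exp (inner ℝ y z) - 1)
            (hexp.sub (integrable_const _)) hin, integral_sub hexp (integrable_const _),
            integral_inner hid]
          simp [sub_eq_add_neg]
      _ ≤ ∫ z, ‖y‖ ^ 2 * Real.exp ‖y‖ * min 1 (‖z‖ ^ 2) ∂ρ := by
          refine integral_mono_ae ((hexp.sub (integrable_const _)).sub hin)
            (hν.integrable_min.integrableOn.const_mul _) ?_
          filter_upwards [hle, habs] with z hz hz'
          refine (exp_sub_one_sub_le _).trans ?_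
          rw [min_eq_right (by nlinarith [norm_nonneg z])]
          have h1 : (inner ℝ y z) ^ 2 ≤ (‖y‖ * ‖z‖) ^ 2 := by
            rw [← sq_abs (inner ℝ y z)]
            exact pow_le_pow_left₀ (abs_nonneg _) (abs_real_inner_le_norm y z) 2
          calc (inner ℝ y z) ^ 2 * Real.exp |inner ℝ y z|
              ≤ (‖y‖ * ‖z‖) ^ 2 * Real.exp ‖y‖ := by gcongr
            _ = _ := by ring
      _ ≤ ‖y‖ ^ 2 * Real.exp ‖y‖ * ∫ z, min 1 (‖z‖ ^ 2) ∂ν := by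
          rw [integral_const_mul]
          refine mul_le_mul_of_nonneg_left ?_ (by positivity)
          exact setIntegral_le_integral hν.integrable_min
            (Eventually.of_forall fun z => by positivity)
  rw [smallPart, lintegral_map (by fun_prop) (by fun_prop)]
  simp_rw [inner_add_right, Real.exp_add, ENNReal.ofReal_mul (Real.exp_pos _).le]
  rw [lintegral_mul_const _ (by fun_prop), inner_neg_right]
  calc _ ≤ ENNReal.ofReal (Real.exp ((∫ z, Real.exp (inner ℝ y z) ∂ρ) - ρ.real Set.univ))
        * ENNReal.ofReal (Real.exp (-inner ℝ y (∫ z, z ∂ρ))) := by gcongr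
    _ ≤ _ := by
        rw [← ENNReal.ofReal_mul (Real.exp_pos _).le, ← Real.exp_add]
        exact ENNReal.ofReal_le_ofReal (Real.exp_le_exp.2 hexponent)

theorem norm_le_sum_abs (x : Space d) : ‖x‖ ≤ ∑ i, |x i| := by
  conv_lhs => rw [← (EuclideanSpace.basisFun (Fin d) ℝ).sum_repr x]
  refine (norm_sum_le _ _).trans (Finset.sum_le_sum fun i _ => ?_)
  simp [norm_smul]

/-- The norm is at most d times the largest coordinate in absolute value, so one of the linear
exponentials dominates. The summand 1 covers d = 0. -/
theorem exp_norm_le_sum {θ : ℝ} (hθ : 0 ≤ θ) (x : Space d) :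
    Real.exp (θ * ‖x‖) ≤ 1 + ∑ i, (Real.exp (inner ℝ (EuclideanSpace.single i (θ * d)) x)
      + Real.exp (inner ℝ (EuclideanSpace.single i (-(θ * d))) x)) := by
  have hnn : ∀ i : Fin d, 0 ≤ Real.exp (inner ℝ (EuclideanSpace.single i (θ * d)) x)
      + Real.exp (inner ℝ (EuclideanSpace.single i (-(θ * d))) x) := fun i => by positivity
  rcases isEmpty_or_nonempty (Fin d) with hd | hd
  · have : ‖x‖ ≤ 0 := by simpa using norm_le_sum_abs x
    have : ‖x‖ = 0 := le_antisymm this (norm_nonneg x)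
    simp [this]
  · obtain ⟨i, -, hi⟩ := Finset.exists_max_image Finset.univ (fun i => |x i|)
      Finset.univ_nonempty
    have h1 : ‖x‖ ≤ d * |x i| := by
      refine (norm_le_sum_abs x).trans ((Finset.sum_le_sum fun j hj => hi j hj).trans ?_)
      simp
    have h2 : Real.exp (θ * ‖x‖) ≤ Real.exp (inner ℝ (EuclideanSpace.single i (θ * d)) x)
        + Real.exp (inner ℝ (EuclideanSpace.single i (-(θ * d))) x) := by
      have h3 : θ * ‖x‖ ≤ |θ * d * x i| := by
        rw [abs_mul, abs_of_nonneg (by positivity : 0 ≤ θ * d), mul_assoc]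
        gcongr
      refine (Real.exp_le_exp.2 h3).trans ?_
      rw [EuclideanSpace.inner_single_left, EuclideanSpace.inner_single_left]
      simp only [conj_trivial, neg_mul]
      exact Real.exp_abs_le _
    have h4 := Finset.single_le_sum (fun j _ => hnn j) (Finset.mem_univ i)
    linarith

theorem IsLevyMeasure.exists_lintegral_exp_norm_smallPart_le {ν : Measure (Space d)}
    (hν : IsLevyMeasure ν) {θ : ℝ} (hθ : 0 ≤ θ) :
    ∃ C : ℝ, 0 < C ∧ ∀ n,
      ∫⁻ x, ENNReal.ofReal (Real.exp (θ * ‖x‖)) ∂(smallPart ν n) ≤ ENNReal.ofReal C := by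
  set b : Space d → ℝ :=
    fun y => Real.exp (‖y‖ ^ 2 * Real.exp ‖y‖ * ∫ z, min 1 (‖z‖ ^ 2) ∂ν) with hb
  have hb0 : ∀ y, 0 < b y := fun y => Real.exp_pos _
  refine ⟨1 + ∑ i, (b (EuclideanSpace.single i (θ * d)) + b (EuclideanSpace.single i (-(θ * d)))),
    ?_, fun n => ?_⟩
  · have : 0 ≤ ∑ i : Fin d, (b (EuclideanSpace.single i (θ * d))
        + b (EuclideanSpace.single i (-(θ * d)))) :=
      Finset.sum_nonneg fun i _ => add_nonneg (hb0 _).le (hb0 _).le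
    linarith
  have := hν.isProbabilityMeasure_smallPart n
  refine (lintegral_mono fun x => ENNReal.ofReal_le_ofReal (exp_norm_le_sum hθ x)).trans ?_
  have hsplit : ∀ a c : Fin d → ℝ, (∀ i, 0 ≤ a i) → (∀ i, 0 ≤ c i) →
      ENNReal.ofReal (1 + ∑ i, (a i + c i))
        = 1 + ∑ i, (ENNReal.ofReal (a i) + ENNReal.ofReal (c i)) := by
    intro a c ha hc
    rw [ENNReal.ofReal_add zero_le_one (Finset.sum_nonneg fun i _ => add_nonneg (ha i) (hc i)),
      ENNReal.ofReal_one, ENNReal.ofReal_sum_of_nonneg fun i _ => add_nonneg (ha i) (hc i)]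
    simp_rw [fun i => ENNReal.ofReal_add (ha i) (hc i)]
  rw [hsplit _ _ (fun i => (hb0 _).le) (fun i => (hb0 _).le)]
  simp_rw [fun x : Space d => hsplit
    (fun i => Real.exp (inner ℝ (EuclideanSpace.single i (θ * d)) x))
    (fun i => Real.exp (inner ℝ (EuclideanSpace.single i (-(θ * d))) x))
    (fun i => (Real.exp_pos _).le) (fun i => (Real.exp_pos _).le)]
  rw [lintegral_add_left measurable_const, lintegral_const, measure_univ, mul_one,
    lintegral_finsetSum _ (fun i _ => by fun_prop)]
  gcongr with i
  rw [lintegral_add_left (by fun_prop)]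
  exact add_le_add (hν.lintegral_exp_inner_smallPart_le n _)
    (hν.lintegral_exp_inner_smallPart_le n _)

/-! ### Comparison of the moments of `μ` and of `ν` -/

/-- Submultiplicativity separates the small and large parts: the first is controlled by `hexp`, the
second by `hν`. -/
theorem IsPurelyNonGaussianWith.lintegral_lt_top_of_submultiplicative {μ ν : Measure (Space d)}
    (h : IsPurelyNonGaussianWith μ ν) {g : Space d → ℝ} (hc : Continuous g) (hnn : ∀ x, 0 ≤ g x)
    (h0 : g 0 ≤ 1) (hmul : ∀ x y, g (x + y) ≤ g x * g y) {θ : ℝ} (hθ : 0 ≤ θ)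
    (hexp : ∀ x, g x ≤ Real.exp (θ * ‖x‖))
    (hν : ∫⁻ z in {z | 1 < ‖z‖}, ENNReal.ofReal (g z) ∂ν < ⊤) :
    ∫⁻ x, ENNReal.ofReal (g x) ∂μ < ⊤ := by
  obtain ⟨η, μs, μ', hμs, rfl, hlim⟩ := h.exists_tendsto_truncatedLaw
  have hL : IsLevyMeasure ν := h.2.1
  have := hL.isFiniteMeasure_largeJumps
  have := hL.isProbabilityMeasure_largePart η
  obtain ⟨C, -, hC⟩ := hL.exists_lintegral_exp_norm_smallPart_le hθ
  have hmul' : ∀ x y, ENNReal.ofReal (g (x + y)) ≤ ENNReal.ofReal (g x) * ENNReal.ofReal (g y) :=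
    fun x y => by
      rw [← ENNReal.ofReal_mul (hnn x)]
      exact ENNReal.ofReal_le_ofReal (hmul x y)
  have hm : Measurable fun x => ENNReal.ofReal (g x) := hc.measurable.ennreal_ofReal
  have hlarge : ∫⁻ x, ENNReal.ofReal (g x) ∂(largePart ν η) < ⊤ := by
    rw [largePart, lintegral_map hm (by fun_prop)]
    calc ∫⁻ x, ENNReal.ofReal (g (x + η)) ∂(compoundPoisson (largeJumps ν))
        ≤ ∫⁻ x, ENNReal.ofReal (g x) * ENNReal.ofReal (g η) ∂(compoundPoisson (largeJumps ν)) :=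
          lintegral_mono fun x => hmul' x η
      _ = (∫⁻ x, ENNReal.ofReal (g x) ∂(compoundPoisson (largeJumps ν)))
            * ENNReal.ofReal (g η) := lintegral_mul_const _ hm
      _ < ⊤ := by
          refine ENNReal.mul_lt_top (lt_of_le_of_lt (lintegral_compoundPoisson_le _ hm
            (by simpa using h0) hmul' ENNReal.toReal_nonneg
            (ENNReal.ofReal_toReal hν.ne).ge) ENNReal.ofReal_lt_top) ENNReal.ofReal_lt_top
  have hbound : ∀ n, ∫⁻ x, ENNReal.ofReal (g x) ∂(μs n : Measure (Space d))
      ≤ ENNReal.ofReal C * ∫⁻ x, ENNReal.ofReal (g x) ∂(largePart ν η) := by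
    intro n
    rw [hμs, truncatedLaw, Measure.lintegral_conv hm]
    calc ∫⁻ x, ∫⁻ y, ENNReal.ofReal (g (x + y)) ∂(largePart ν η) ∂(smallPart ν n)
        ≤ ∫⁻ x, ∫⁻ y, ENNReal.ofReal (g x) * ENNReal.ofReal (g y)
            ∂(largePart ν η) ∂(smallPart ν n) :=
          lintegral_mono fun x => lintegral_mono fun y => hmul' x y
      _ = (∫⁻ x, ENNReal.ofReal (g x) ∂(smallPart ν n))
            * ∫⁻ x, ENNReal.ofReal (g x) ∂(largePart ν η) := by
          simp_rw [lintegral_const_mul _ hm]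
          rw [lintegral_mul_const _ hm]
      _ ≤ _ := by
          gcongr
          exact (lintegral_mono fun x => ENNReal.ofReal_le_ofReal (hexp x)).trans (hC n)
  -- Weak convergence only gives lower semicontinuity for unbounded continuous g ≥ 0, which is the
  -- direction needed.
  have hfatou := lintegral_le_liminf_lintegral_of_forall_isOpen_measure_le_liminf_measure
    (μ := (μ' : Measure (Space d))) (μs := fun n => (μs n : Measure (Space d))) hc hnn
    fun G hG => ProbabilityMeasure.le_liminf_measure_open_of_tendsto hlim hG
  refine lt_of_le_of_lt (hfatou.trans ?_) (ENNReal.mul_lt_top (ENNReal.ofReal_lt_top (r := C)) hlarge)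
  exact (liminf_le_liminf (Eventually.of_forall hbound)).trans (liminf_const _).le

/-- Markov's inequality with the uniform exponential moment C; the level 2C works because s ≤ e^s.
-/
theorem IsLevyMeasure.exists_half_le_smallPart_norm_lt {ν : Measure (Space d)}
    (hν : IsLevyMeasure ν) :
    ∃ K : ℝ, 0 < K ∧ ∀ n, 2⁻¹ ≤ smallPart ν n {x | ‖x‖ < K} := by
  obtain ⟨C, hC0, hC⟩ := hν.exists_lintegral_exp_norm_smallPart_le zero_le_one
  refine ⟨2 * C, by positivity, fun n => ?_⟩
  have := hν.isProbabilityMeasure_smallPart n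
  have hmarkov := mul_meas_ge_le_lintegral (μ := smallPart ν n)
    (f := fun x => ENNReal.ofReal (Real.exp (1 * ‖x‖))) (by fun_prop) (ENNReal.ofReal (2 * C))
  have hsub : {x : Space d | ‖x‖ < 2 * C}ᶜ
      ⊆ {x | ENNReal.ofReal (2 * C) ≤ ENNReal.ofReal (Real.exp (1 * ‖x‖))} := by
    intro x hx
    have hx' : 2 * C ≤ ‖x‖ := not_lt.1 hx
    refine ENNReal.ofReal_le_ofReal ?_
    linarith [Real.add_one_le_exp (1 * ‖x‖)]
  have hle : smallPart ν n {x | ‖x‖ < 2 * C}ᶜ ≤ 2⁻¹ := by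
    have h1 : ENNReal.ofReal (2 * C) * smallPart ν n {x | ‖x‖ < 2 * C}ᶜ ≤ ENNReal.ofReal C :=
      (mul_le_mul_right (measure_mono hsub) _).trans (hmarkov.trans (hC n))
    rw [ENNReal.ofReal_mul two_pos.le, mul_comm (ENNReal.ofReal 2), mul_assoc] at h1
    have h2 : ENNReal.ofReal 2 * smallPart ν n {x | ‖x‖ < 2 * C}ᶜ ≤ 1 := by
      rw [← ENNReal.mul_le_mul_iff_right (a := ENNReal.ofReal C) (by simpa using hC0)
        ENNReal.ofReal_ne_top, mul_one]
      exact h1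
    rw [ENNReal.ofReal_ofNat] at h2
    rw [← one_div, ENNReal.le_div_iff_mul_le (by simp) (by simp), mul_comm]
    exact h2
  have hms : MeasurableSet {x : Space d | ‖x‖ < 2 * C} :=
    measurableSet_lt measurable_norm measurable_const
  have hadd := measure_add_measure_compl (μ := smallPart ν n) hms
  rw [measure_univ] at hadd
  have h3 : (2⁻¹ : ℝ≥0∞) + 2⁻¹ ≤ smallPart ν n {x | ‖x‖ < 2 * C} + 2⁻¹ := by
    rw [ENNReal.inv_two_add_inv_two, ← hadd]
    gcongr
  exact (ENNReal.add_le_add_iff_right (by simp)).1 h3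

/-- One large jump suffices: with probability at least 1/2 the small part moves it by less than K,
and the drift by at most ‖η‖. The bound survives the limit because the tail set is closed. -/
theorem IsPurelyNonGaussianWith.exists_mul_measure_le {μ ν : Measure (Space d)}
    (h : IsPurelyNonGaussianWith μ ν) :
    ∃ c K : ℝ, 0 < c ∧ 0 < K ∧ ∀ t : ℝ, 1 ≤ t →
      ENNReal.ofReal c * ν {z | t + K ≤ ‖z‖} ≤ μ {x | t ≤ ‖x‖} := by
  obtain ⟨η, μs, μ', hμs, rfl, hlim⟩ := h.exists_tendsto_truncatedLaw
  have hL : IsLevyMeasure ν := h.2.1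
  have := hL.isFiniteMeasure_largeJumps
  have := hL.isProbabilityMeasure_largePart η
  obtain ⟨K, hK0, hK⟩ := hL.exists_half_le_smallPart_norm_lt
  set a := Real.exp (-(largeJumps ν).real Set.univ) with ha
  have ha0 : 0 < a := Real.exp_pos _
  refine ⟨2⁻¹ * a, K + ‖η‖, by positivity, by positivity, fun t ht => ?_⟩
  have hmle : ∀ s : ℝ, MeasurableSet {x : Space d | s ≤ ‖x‖} := fun s =>
    measurableSet_le measurable_const measurable_norm
  have hlarge : ENNReal.ofReal a * ν {z | t + (K + ‖η‖) ≤ ‖z‖}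
      ≤ largePart ν η {y | t + K ≤ ‖y‖} := by
    rw [largePart, Measure.map_apply (by fun_prop) (hmle _)]
    calc ENNReal.ofReal a * ν {z | t + (K + ‖η‖) ≤ ‖z‖}
        = (ENNReal.ofReal a • largeJumps ν) {z | t + (K + ‖η‖) ≤ ‖z‖} := by
          rw [Measure.smul_apply, smul_eq_mul, largeJumps, Measure.restrict_apply (hmle _)]
          congr 2
          refine (Set.inter_eq_left.2 fun z hz => ?_).symm
          have hz' : t + (K + ‖η‖) ≤ ‖z‖ := hz
          change 1 < ‖z‖
          linarith [norm_nonneg η]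
      _ ≤ compoundPoisson (largeJumps ν) {z | t + (K + ‖η‖) ≤ ‖z‖} :=
          smul_le_compoundPoisson (largeJumps ν) _
      _ ≤ _ := by
          refine measure_mono fun z hz => ?_
          have hz' : t + (K + ‖η‖) ≤ ‖z‖ := hz
          change t + K ≤ ‖z + η‖
          have := norm_sub_le (z + η) η
          rw [add_sub_cancel_right] at this
          linarith
  have hn : ∀ n, ENNReal.ofReal (2⁻¹ * a) * ν {z | t + (K + ‖η‖) ≤ ‖z‖}
      ≤ (μs n : Measure (Space d)) {x | t ≤ ‖x‖} := by
    intro n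
    have hms : MeasurableSet {x : Space d | ‖x‖ < K} :=
      measurableSet_lt measurable_norm measurable_const
    rw [hμs, truncatedLaw, ← lintegral_indicator_one (hmle t),
      Measure.lintegral_conv (measurable_one.indicator (hmle t))]
    calc ENNReal.ofReal (2⁻¹ * a) * ν {z | t + (K + ‖η‖) ≤ ‖z‖}
        = (ENNReal.ofReal a * ν {z | t + (K + ‖η‖) ≤ ‖z‖}) * 2⁻¹ := by
          rw [ENNReal.ofReal_mul (by positivity), ENNReal.ofReal_inv_of_pos two_pos,
            ENNReal.ofReal_ofNat, mul_assoc, mul_comm]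
      _ ≤ largePart ν η {y | t + K ≤ ‖y‖} * smallPart ν n {x | ‖x‖ < K} :=
          mul_le_mul' hlarge (hK n)
      _ = ∫⁻ x in {x | ‖x‖ < K}, largePart ν η {y | t + K ≤ ‖y‖} ∂(smallPart ν n) := by
          rw [setLIntegral_const]
      _ ≤ ∫⁻ x in {x | ‖x‖ < K}, ∫⁻ y, {x | t ≤ ‖x‖}.indicator 1 (x + y)
            ∂(largePart ν η) ∂(smallPart ν n) := by
          refine setLIntegral_mono' hms fun x hx => ?_
          rw [← lintegral_indicator_one (hmle (t + K))]
          refine lintegral_mono fun y => ?_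
          by_cases hy : y ∈ {y : Space d | t + K ≤ ‖y‖}
          swap
          · simp [Set.indicator_of_notMem hy]
          have hx' : ‖x‖ < K := hx
          have hy' : t + K ≤ ‖y‖ := hy
          have hxy : x + y ∈ {x : Space d | t ≤ ‖x‖} := by
            change t ≤ ‖x + y‖
            have := norm_sub_le (x + y) x
            rw [add_sub_cancel_left] at this
            linarith
          rw [Set.indicator_of_mem hxy, Set.indicator_of_mem hy]
          rfl
      _ ≤ _ := setLIntegral_le_lintegral _ _
  have hclosed : IsClosed {x : Space d | t ≤ ‖x‖} := isClosed_le continuous_const continuous_norm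
  refine le_trans ?_ (ProbabilityMeasure.limsup_measure_closed_le_of_tendsto hlim hclosed)
  exact (limsup_const _).ge.trans (limsup_le_limsup (Eventually.of_forall hn))

/-! ### The Lévy measure in polar coordinates -/

/-- The polar formula, given for sets only, identifies `ν` as the image of a density against σ ⊗ dr;
change of variables then extends it to functions. -/
theorem HasPolarForm.lintegral_eq {ν : Measure (Space d)} {σ : Measure (UnitSphere d)}
    [SFinite σ] {q : ℝ → UnitSphere d → ℝ} (h : HasPolarForm ν σ q)
    (hq : Measurable (Function.uncurry q)) {f : Space d → ℝ≥0∞} (hf : Measurable f) :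
    ∫⁻ z, f z ∂ν = ∫⁻ ξ, (∫⁻ r in Set.Ioi (0 : ℝ),
      ENNReal.ofReal (q r ξ) * f (r • (ξ : Space d))) ∂σ := by
  have hq' : Measurable fun p : UnitSphere d × ℝ => ENNReal.ofReal (q p.2 p.1) :=
    (hq.comp measurable_swap).ennreal_ofReal
  have hmap : Measurable fun p : UnitSphere d × ℝ => p.2 • (p.1 : Space d) := by fun_prop
  have hprod : ∀ g : Space d → ℝ≥0∞, Measurable g →
      ∫⁻ z, g z ∂(((σ.prod (volume.restrict (Set.Ioi (0 : ℝ)))).withDensity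
        fun p => ENNReal.ofReal (q p.2 p.1)).map fun p => p.2 • (p.1 : Space d))
      = ∫⁻ ξ, (∫⁻ r in Set.Ioi (0 : ℝ), ENNReal.ofReal (q r ξ) * g (r • (ξ : Space d))) ∂σ := by
    intro g hg
    have hg' : Measurable fun p : UnitSphere d × ℝ => g (p.2 • (p.1 : Space d)) := hg.comp hmap
    rw [lintegral_map hg hmap, lintegral_withDensity_eq_lintegral_mul _ hq' hg',
      lintegral_prod _ (hq'.mul hg').aemeasurable]
    rfl
  have hν : ν = ((σ.prod (volume.restrict (Set.Ioi (0 : ℝ)))).withDensity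
      fun p => ENNReal.ofReal (q p.2 p.1)).map fun p => p.2 • (p.1 : Space d) := by
    ext B hB
    rw [h B hB, ← lintegral_indicator_one hB, hprod _ (measurable_one.indicator hB)]
    refine lintegral_congr fun ξ => lintegral_congr fun r => ?_
    by_cases hr : r • (ξ : Space d) ∈ B <;> simp [hr]
  conv_lhs => rw [hν]
  exact hprod f hf

theorem norm_smul_unitSphere {r : ℝ} (hr : 0 ≤ r) (ξ : UnitSphere d) :
    ‖r • (ξ : Space d)‖ = r := by
  rw [norm_smul, norm_eq_of_mem_sphere, mul_one, Real.norm_of_nonneg hr]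

/-- Integrals of radial functions against a measure in polar form, away from the origin. -/
theorem HasPolarForm.lintegral_radial_eq {ν : Measure (Space d)} {σ : Measure (UnitSphere d)}
    [SFinite σ] {q : ℝ → UnitSphere d → ℝ} (h : HasPolarForm ν σ q)
    (hq : Measurable (Function.uncurry q)) {f : ℝ → ℝ≥0∞} (hf : Measurable f) {s : ℝ}
    (hs : 0 ≤ s) :
    ∫⁻ z in {z | s < ‖z‖}, f ‖z‖ ∂ν
      = ∫⁻ ξ, (∫⁻ r in Set.Ioi s, ENNReal.ofReal (q r ξ) * f r) ∂σ := by
  have hms : MeasurableSet {z : Space d | s < ‖z‖} :=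
    measurableSet_lt measurable_const measurable_norm
  have hf' : Measurable fun z : Space d => f ‖z‖ := hf.comp measurable_norm
  rw [← lintegral_indicator hms, HasPolarForm.lintegral_eq h hq (hf'.indicator hms)]
  refine lintegral_congr fun ξ => ?_
  rw [← lintegral_indicator measurableSet_Ioi, ← lintegral_indicator measurableSet_Ioi]
  refine lintegral_congr fun r => ?_
  by_cases hr : s < r
  · have hr0 : 0 < r := hs.trans_lt hr
    have hmem : r • (ξ : Space d) ∈ {z : Space d | s < ‖z‖} := by
      change s < ‖r • (ξ : Space d)‖
      rwa [norm_smul_unitSphere hr0.le]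
    rw [Set.indicator_of_mem (Set.mem_Ioi.2 hr0), Set.indicator_of_mem (Set.mem_Ioi.2 hr),
      Set.indicator_of_mem hmem, norm_smul_unitSphere hr0.le]
  · rw [Set.indicator_of_notMem (s := Set.Ioi s) (fun hh => hr (Set.mem_Ioi.1 hh))]
    by_cases hr0 : 0 < r
    · have hmem : r • (ξ : Space d) ∉ {z : Space d | s < ‖z‖} := by
        change ¬ s < ‖r • (ξ : Space d)‖
        rwa [norm_smul_unitSphere hr0.le]
      rw [Set.indicator_of_mem (Set.mem_Ioi.2 hr0), Set.indicator_of_notMem hmem, mul_zero]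
    · rw [Set.indicator_of_notMem (fun hh => hr0 (Set.mem_Ioi.1 hh))]

theorem lintegral_Ioi_rpow {a s : ℝ} (ha : a < -1) (hs : 0 < s) :
    ∫⁻ r in Set.Ioi s, ENNReal.ofReal (r ^ a) = ENNReal.ofReal (-s ^ (a + 1) / (a + 1)) := by
  rw [← integral_Ioi_rpow_of_lt ha hs, ofReal_integral_eq_lintegral_ofReal
    (integrableOn_Ioi_rpow_of_lt ha hs)]
  filter_upwards [ae_restrict_mem measurableSet_Ioi] with r hr
  exact Real.rpow_nonneg (hs.trans hr).le a

theorem lintegral_Ioi_inv (s : ℝ) (hs : 0 < s) :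
    ∫⁻ r in Set.Ioi s, ENNReal.ofReal r⁻¹ = ⊤ := by
  by_contra hne
  refine not_integrableOn_Ioi_inv (a := s) ⟨by fun_prop, ?_⟩
  rw [hasFiniteIntegral_iff_ofReal]
  · exact lt_top_iff_ne_top.2 hne
  · filter_upwards [ae_restrict_mem measurableSet_Ioi] with r hr
    exact inv_nonneg.2 (hs.trans hr).le

theorem LongUniform.coeff_nonneg {β : ℝ} {q : ℝ → UnitSphere d → ℝ} {c₂ : UnitSphere d → ℝ}
    (h : LongUniform β q c₂) (ξ : UnitSphere d) : 0 ≤ c₂ ξ := by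
  -- Any ε would do: the right side of the estimate at r = R bounds an absolute value.
  obtain ⟨R, hR, hq⟩ := h 1 one_pos
  have h1 := (abs_nonneg _).trans (hq ξ R le_rfl)
  rw [one_mul] at h1
  exact nonneg_of_mul_nonneg_left h1 (Real.rpow_pos_of_pos hR _)

theorem LongUniform.exists_bounds {β : ℝ} {q : ℝ → UnitSphere d → ℝ} {c₂ : UnitSphere d → ℝ}
    (h : LongUniform β q c₂) : ∃ R : ℝ, 1 ≤ R ∧ ∀ ξ, ∀ r : ℝ, R ≤ r →
      c₂ ξ * r ^ (-β - 1) ≤ 2 * q r ξ ∧ q r ξ ≤ 2 * (c₂ ξ * r ^ (-β - 1)) := by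
  obtain ⟨R, hR, hq⟩ := h (1 / 2) (by norm_num)
  refine ⟨max 1 R, le_max_left _ _, fun ξ r hr => ?_⟩
  have h1 := abs_le.1 (hq ξ r ((le_max_right _ _).trans hr))
  have h2 : 0 ≤ c₂ ξ * r ^ (-β - 1) :=
    mul_nonneg (h.coeff_nonneg ξ) (Real.rpow_nonneg (by linarith [le_max_left 1 R]) _)
  constructor <;> linarith

theorem sphericalWithDensity_univ (σ : Measure (UnitSphere d)) (c₂ : UnitSphere d → ℝ) :
    sphericalWithDensity σ c₂ Set.univ = ∫⁻ ξ, ENNReal.ofReal (c₂ ξ) ∂σ := by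
  rw [sphericalWithDensity, withDensity_apply _ MeasurableSet.univ, setLIntegral_univ]

/-! ### Tails of the Lévy measure under the uniform asymptotics -/

section Tails

variable {α β : ℝ} {σ : Measure (UnitSphere d)} {q : ℝ → UnitSphere d → ℝ}
  {c₁ c₂ : UnitSphere d → ℝ} {ν μ : Measure (Space d)}

theorem IsLayeredStable.exists_lintegral_rpow_lt_top (hμ : IsLayeredStable α β σ q c₁ c₂ ν μ)
    (hunif : LongUniform β q c₂) {p : ℝ} (hp : p < β) :
    ∃ R : ℝ, 1 ≤ R ∧ ∫⁻ z in {z | R < ‖z‖}, ENNReal.ofReal (‖z‖ ^ p) ∂ν < ⊤ := by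
  have := hμ.finite_spherical
  obtain ⟨R, hR1, hR⟩ := hunif.exists_bounds
  have hR0 : 0 < R := one_pos.trans_le hR1
  refine ⟨R, hR1, ?_⟩
  rw [HasPolarForm.lintegral_radial_eq hμ.polar hμ.measurable_q (f := fun r => ENNReal.ofReal (r ^ p))
    (by fun_prop) hR0.le]
  set A := ∫⁻ r in Set.Ioi R, ENNReal.ofReal (r ^ (p - β - 1)) with hA
  have hAt : A < ⊤ := by
    rw [hA, lintegral_Ioi_rpow (by linarith) hR0]
    exact ENNReal.ofReal_lt_top
  have hle : ∀ ξ, ∫⁻ r in Set.Ioi R, ENNReal.ofReal (q r ξ) * ENNReal.ofReal (r ^ p)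
      ≤ ENNReal.ofReal (2 * c₂ ξ) * A := by
    intro ξ
    rw [hA, ← lintegral_const_mul _ (by fun_prop)]
    refine setLIntegral_mono' measurableSet_Ioi fun r hr => ?_
    have hr0 : 0 < r := hR0.trans hr
    have hc := hunif.coeff_nonneg ξ
    rw [← ENNReal.ofReal_mul (hμ.q_nonneg r hr0 ξ), ← ENNReal.ofReal_mul (by positivity)]
    refine ENNReal.ofReal_le_ofReal ?_
    calc q r ξ * r ^ p ≤ 2 * (c₂ ξ * r ^ (-β - 1)) * r ^ p := by
          gcongr
          exact (hR ξ r (le_of_lt hr)).2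
      _ = 2 * c₂ ξ * r ^ (p - β - 1) := by
          rw [show p - β - 1 = (-β - 1) + p by ring, Real.rpow_add hr0]; ring
  refine (lintegral_mono hle).trans_lt ?_
  rw [lintegral_mul_const' _ _ hAt.ne]
  exact ENNReal.mul_lt_top (hμ.integrable_c₂.const_mul 2).lintegral_lt_top hAt

/-- In directions with c₂ = 0 the relative error bound forces q = 0 beyond a radius R common to all
directions. -/
theorem IsLayeredStable.exists_measure_lt_norm_eq_zero (hμ : IsLayeredStable α β σ q c₁ c₂ ν μ)
    (hunif : LongUniform β q c₂) (hσ : sphericalWithDensity σ c₂ Set.univ = 0) :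
    ∃ R : ℝ, 1 ≤ R ∧ ν {z | R < ‖z‖} = 0 := by
  have := hμ.finite_spherical
  obtain ⟨R, hR1, hR⟩ := hunif.exists_bounds
  refine ⟨R, hR1, ?_⟩
  have h1 := HasPolarForm.lintegral_radial_eq hμ.polar hμ.measurable_q (f := fun _ => 1)
    measurable_const (zero_le_one.trans hR1)
  rw [setLIntegral_one] at h1
  rw [h1]
  rw [sphericalWithDensity_univ, lintegral_eq_zero_iff'
    hμ.integrable_c₂.aemeasurable.ennreal_ofReal] at hσ
  refine (lintegral_congr_ae (g := 0) ?_).trans lintegral_zero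
  filter_upwards [hσ] with ξ hξ
  have hc : c₂ ξ ≤ 0 := ENNReal.ofReal_eq_zero.1 hξ
  refine (setLIntegral_congr_fun (g := 0) measurableSet_Ioi fun r hr => ?_).trans lintegral_zero
  have hq := (hR ξ r (le_of_lt hr)).2
  rw [le_antisymm hc (hunif.coeff_nonneg ξ), zero_mul, mul_zero] at hq
  simp [ENNReal.ofReal_eq_zero.2 hq]

/-- Integrate the lower bound q ≥ c₂ r^(-β-1) / 2 over r > s. -/
theorem IsLayeredStable.exists_le_measure_norm (hμ : IsLayeredStable α β σ q c₁ c₂ ν μ)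
    (hunif : LongUniform β q c₂) :
    ∃ R : ℝ, 1 ≤ R ∧ ∀ s : ℝ, R ≤ s →
      sphericalWithDensity σ c₂ Set.univ * ENNReal.ofReal (s ^ (-β) / (2 * β))
        ≤ ν {z | s ≤ ‖z‖} := by
  have := hμ.finite_spherical
  have hβ := hμ.outer_pos
  obtain ⟨R, hR1, hR⟩ := hunif.exists_bounds
  refine ⟨R, hR1, fun s hs => ?_⟩
  have hs0 : 0 < s := by linarith
  refine le_trans ?_ (measure_mono (s := {z : Space d | s < ‖z‖}) fun z (hz : s < ‖z‖) => hz.le)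
  have h1 := HasPolarForm.lintegral_radial_eq hμ.polar hμ.measurable_q (f := fun _ => 1)
    measurable_const hs0.le
  rw [setLIntegral_one] at h1
  rw [h1, sphericalWithDensity_univ, ← lintegral_mul_const' _ _ ENNReal.ofReal_ne_top]
  refine lintegral_mono fun ξ => ?_
  have hc := hunif.coeff_nonneg ξ
  have h2 : s ^ (-β) / (2 * β) = 2⁻¹ * (-s ^ (-β - 1 + 1) / (-β - 1 + 1)) := by
    rw [sub_add_cancel]; field_simp
  rw [h2, ENNReal.ofReal_mul (by positivity), ← lintegral_Ioi_rpow (by linarith) hs0, ← mul_assoc,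
    ← ENNReal.ofReal_mul hc, ← lintegral_const_mul _ (by fun_prop)]
  refine setLIntegral_mono' measurableSet_Ioi fun r hr => ?_
  rw [← ENNReal.ofReal_mul (by positivity), mul_one]
  refine ENNReal.ofReal_le_ofReal ?_
  have := (hR ξ r (hs.trans (le_of_lt hr))).1
  linarith

end Tails

/-! ### Moments -/

/-- In the layer-cake formula the tail t^(-β) meets the weight t^(β-1), leaving the divergent
integral of 1/t. -/
theorem absMoment_eq_top_of_le_tail {μ : Measure (Space d)} {β T : ℝ} (hβ : 0 < β) (hT : 0 < T)
    {A : ℝ≥0∞} (hA : A ≠ 0)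
    (h : ∀ t, T ≤ t → A * ENNReal.ofReal (t ^ (-β)) ≤ μ {x | t ≤ ‖x‖}) :
    absMoment μ β = ⊤ := by
  rw [absMoment, lintegral_rpow_eq_lintegral_meas_le_mul μ
    (Eventually.of_forall fun x => norm_nonneg x) (by fun_prop) hβ]
  have hinf : ∫⁻ t in Set.Ioi (0 : ℝ), μ {x : Space d | t ≤ ‖x‖} * ENNReal.ofReal (t ^ (β - 1))
      = ⊤ := by
    rw [eq_top_iff]
    calc (⊤ : ℝ≥0∞) = A * ∫⁻ r in Set.Ioi T, ENNReal.ofReal r⁻¹ := by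
          rw [lintegral_Ioi_inv T hT, ENNReal.mul_top hA]
      _ = ∫⁻ r in Set.Ioi T, A * ENNReal.ofReal r⁻¹ := by
          rw [lintegral_const_mul _ (by fun_prop)]
      _ ≤ ∫⁻ t in Set.Ioi T, μ {x : Space d | t ≤ ‖x‖} * ENNReal.ofReal (t ^ (β - 1)) := by
          refine setLIntegral_mono' measurableSet_Ioi fun t ht => ?_
          have ht0 : 0 < t := hT.trans ht
          have h1 : t⁻¹ = t ^ (-β) * t ^ (β - 1) := by
            rw [← Real.rpow_add ht0, ← Real.rpow_neg_one]; congr 1; ring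
          rw [h1, ENNReal.ofReal_mul (Real.rpow_nonneg ht0.le _), ← mul_assoc]
          gcongr
          exact h t (le_of_lt ht)
      _ ≤ _ := lintegral_mono_set (Set.Ioi_subset_Ioi hT.le)
  rw [hinf, ENNReal.mul_top]
  simpa using hβ

section Moments

variable {α β : ℝ} {σ : Measure (UnitSphere d)} {q : ℝ → UnitSphere d → ℝ}
  {c₁ c₂ : UnitSphere d → ℝ} {ν μ : Measure (Space d)}

theorem IsLayeredStable.absMoment_outer_eq_top (hμ : IsLayeredStable α β σ q c₁ c₂ ν μ)
    (hunif : LongUniform β q c₂) (hσ : sphericalWithDensity σ c₂ Set.univ ≠ 0) :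
    absMoment μ β = ⊤ := by
  have hβ := hμ.outer_pos
  obtain ⟨R, hR1, hR⟩ := hμ.exists_le_measure_norm hunif
  obtain ⟨c, K, hc, hK, htail⟩ := hμ.law.exists_mul_measure_le
  -- For t ≥ R + K one has t + K ≤ 2t, so the shift by K costs only the factor 2^(-β).
  refine absMoment_eq_top_of_le_tail hβ (T := R + K) (by linarith)
    (A := ENNReal.ofReal c * (sphericalWithDensity σ c₂ Set.univ
      * ENNReal.ofReal (2 ^ (-β) / (2 * β)))) ?_ fun t ht => ?_
  · refine mul_ne_zero (by simpa using hc) (mul_ne_zero hσ ?_)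
    rw [← pos_iff_ne_zero, ENNReal.ofReal_pos]
    positivity
  · have ht0 : 0 < t := by linarith
    refine le_trans ?_ (htail t (by linarith))
    rw [mul_assoc, mul_assoc]
    gcongr
    refine le_trans ?_ (hR (t + K) (by linarith))
    gcongr
    rw [← ENNReal.ofReal_mul (by positivity)]
    refine ENNReal.ofReal_le_ofReal ?_
    rw [div_mul_eq_mul_div, ← Real.mul_rpow two_pos.le ht0.le]
    refine div_le_div_of_nonneg_right ?_ (by positivity)
    exact Real.rpow_le_rpow_of_nonpos (by linarith) (by linarith) (by linarith)

theorem absMoment_eq_top_mono [IsFiniteMeasure μ] {p : ℝ} (hβ : 0 < β) (hp : β ≤ p)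
    (h : absMoment μ β = ⊤) : absMoment μ p = ⊤ := by
  by_contra hne
  have hle : absMoment μ β ≤ μ Set.univ + absMoment μ p := by
    rw [absMoment, absMoment, ← lintegral_one, ← lintegral_add_left measurable_const]
    refine lintegral_mono fun x => ?_
    rw [← ENNReal.ofReal_one, ← ENNReal.ofReal_add zero_le_one (by positivity)]
    refine ENNReal.ofReal_le_ofReal ?_
    rcases le_total ‖x‖ 1 with hx | hx
    · have := Real.rpow_le_one (norm_nonneg x) hx hβ.le
      have := Real.rpow_nonneg (norm_nonneg x) p
      linarith
    · have := Real.rpow_le_rpow_of_exponent_le hx hp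
      linarith
  rw [h, top_le_iff, ENNReal.add_eq_top] at hle
  exact hle.elim (measure_ne_top μ _) hne

/-- Raise s ≤ e^s, with s = θ‖x‖/p, to the power p. -/
theorem absMoment_le_expMoment {p θ : ℝ} (hp : 0 < p) (hθ : 0 < θ) (μ : Measure (Space d)) :
    absMoment μ p ≤ ENNReal.ofReal ((p / θ) ^ p) * expMoment μ θ := by
  rw [absMoment, expMoment, ← lintegral_const_mul _ (by fun_prop)]
  refine lintegral_mono fun x => ?_
  rw [← ENNReal.ofReal_mul (by positivity)]
  refine ENNReal.ofReal_le_ofReal ?_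
  have h1 : ‖x‖ = p / θ * (θ / p * ‖x‖) := by field_simp
  have h2 : θ / p * ‖x‖ ≤ Real.exp (θ / p * ‖x‖) := by
    linarith [Real.add_one_le_exp (θ / p * ‖x‖)]
  have h3 : (θ / p * ‖x‖) ^ p ≤ Real.exp (θ * ‖x‖) := by
    refine (Real.rpow_le_rpow (by positivity) h2 hp.le).trans_eq ?_
    rw [← Real.exp_mul]
    congr 1
    field_simp
  calc ‖x‖ ^ p = (p / θ) ^ p * (θ / p * ‖x‖) ^ p := by
        rw [← Real.mul_rpow (by positivity) (by positivity), ← h1]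
    _ ≤ _ := by gcongr

theorem IsLayeredStable.expMoment_lt_top (hμ : IsLayeredStable α β σ q c₁ c₂ ν μ)
    (hunif : LongUniform β q c₂) (hσ : sphericalWithDensity σ c₂ Set.univ = 0) {θ : ℝ}
    (hθ : 0 < θ) : expMoment μ θ < ⊤ := by
  obtain ⟨R, -, hR⟩ := hμ.exists_measure_lt_norm_eq_zero hunif hσ
  refine hμ.law.lintegral_lt_top_of_submultiplicative (g := fun x => Real.exp (θ * ‖x‖))
    (by fun_prop) (fun x => (Real.exp_pos _).le) (by simp) (fun x y => ?_) hθ.le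
    (fun x => le_rfl) ?_
  · rw [← Real.exp_add, ← mul_add]
    gcongr
    exact norm_add_le x y
  · calc ∫⁻ z in {z | 1 < ‖z‖}, ENNReal.ofReal (Real.exp (θ * ‖z‖)) ∂ν
        ≤ ∫⁻ z in {z | 1 < ‖z‖}, ENNReal.ofReal (Real.exp (θ * R)) ∂ν := by
          refine setLIntegral_mono_ae' measurableSet_largeJumps ?_
          have hae : ∀ᵐ z ∂ν, ¬ R < ‖z‖ := by
            rw [ae_iff]
            simpa using hR
          filter_upwards [hae] with z hz _
          have hz' := not_lt.1 hz
          gcongr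
      _ < ⊤ := by
          rw [setLIntegral_const]
          exact ENNReal.mul_lt_top ENNReal.ofReal_lt_top
            (hμ.law.2.1.measure_lt_norm_lt_top one_pos)

theorem IsLayeredStable.absMoment_lt_top (hμ : IsLayeredStable α β σ q c₁ c₂ ν μ)
    (hunif : LongUniform β q c₂) {p : ℝ} (hp : 0 < p) (hpβ : p < β) : absMoment μ p < ⊤ := by
  obtain ⟨R, hR1, hR⟩ := hμ.exists_lintegral_rpow_lt_top hunif hpβ
  -- ‖x‖^p is not submultiplicative, but (1 + ‖x‖)^p is, and it is at most e^(p‖x‖).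
  have hmain : ∫⁻ x, ENNReal.ofReal ((1 + ‖x‖) ^ p) ∂μ < ⊤ := by
    refine hμ.law.lintegral_lt_top_of_submultiplicative (g := fun x => (1 + ‖x‖) ^ p)
      ?_ (fun x => by positivity) (by simp) (fun x y => ?_) hp.le (fun x => ?_) ?_
    · exact (continuous_const.add continuous_norm).rpow_const fun x => Or.inr hp.le
    · rw [← Real.mul_rpow (by positivity) (by positivity)]
      refine Real.rpow_le_rpow (by positivity) ?_ hp.le
      nlinarith [norm_add_le x y, mul_nonneg (norm_nonneg x) (norm_nonneg y)]
    · rw [mul_comm, Real.exp_mul]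
      refine Real.rpow_le_rpow (by positivity) ?_ hp.le
      linarith [Real.add_one_le_exp ‖x‖]
    · have hsub : {z : Space d | 1 < ‖z‖} ⊆ {z | 1 < ‖z‖ ∧ ‖z‖ ≤ R} ∪ {z | R < ‖z‖} := by
        intro z hz
        rcases le_or_gt ‖z‖ R with h1 | h1
        · exact Or.inl ⟨hz, h1⟩
        · exact Or.inr h1
      refine ((lintegral_mono_set hsub).trans (lintegral_union_le _ _ _)).trans_lt
        (ENNReal.add_lt_top.2 ⟨?_, ?_⟩)
      · have hms : MeasurableSet {z : Space d | 1 < ‖z‖ ∧ ‖z‖ ≤ R} :=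
          measurableSet_largeJumps.inter (measurableSet_le measurable_norm measurable_const)
        calc ∫⁻ z in {z | 1 < ‖z‖ ∧ ‖z‖ ≤ R}, ENNReal.ofReal ((1 + ‖z‖) ^ p) ∂ν
            ≤ ∫⁻ z in {z | 1 < ‖z‖ ∧ ‖z‖ ≤ R}, ENNReal.ofReal ((1 + R) ^ p) ∂ν := by
              refine setLIntegral_mono' hms fun z hz => ENNReal.ofReal_le_ofReal ?_
              exact Real.rpow_le_rpow (by positivity) (by linarith [hz.2]) hp.le
          _ < ⊤ := by
              rw [setLIntegral_const]
              exact ENNReal.mul_lt_top ENNReal.ofReal_lt_top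
                ((measure_mono fun z hz => hz.1).trans_lt
                  (hμ.law.2.1.measure_lt_norm_lt_top one_pos))
      -- Since R ≥ 1, here 1 + ‖z‖ ≤ 2‖z‖.
      · calc ∫⁻ z in {z | R < ‖z‖}, ENNReal.ofReal ((1 + ‖z‖) ^ p) ∂ν
            ≤ ∫⁻ z in {z | R < ‖z‖}, ENNReal.ofReal (2 ^ p) * ENNReal.ofReal (‖z‖ ^ p) ∂ν := by
              refine setLIntegral_mono' (measurableSet_lt measurable_const measurable_norm)
                fun z hz => ?_
              have hz' : R < ‖z‖ := hz
              rw [← ENNReal.ofReal_mul (by positivity),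
                ← Real.mul_rpow two_pos.le (norm_nonneg z)]
              refine ENNReal.ofReal_le_ofReal ?_
              exact Real.rpow_le_rpow (by positivity) (by linarith) hp.le
          _ < ⊤ := by
              rw [lintegral_const_mul _ (by fun_prop)]
              exact ENNReal.mul_lt_top ENNReal.ofReal_lt_top hR
  refine (lintegral_mono fun x => ENNReal.ofReal_le_ofReal ?_).trans_lt hmain
  exact Real.rpow_le_rpow (norm_nonneg x) (by linarith) hp.le

end Moments

end LayeredStable

theorem mainTheorem4 {d : ℕ} {α β : ℝ}
    {σ : MeasureTheory.Measure (LayeredStable.UnitSphere d)}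
    {q : ℝ → LayeredStable.UnitSphere d → ℝ} {c₁ c₂ : LayeredStable.UnitSphere d → ℝ}
    {ν μ : MeasureTheory.Measure (LayeredStable.Space d)}
    (hμ : LayeredStable.IsLayeredStable α β σ q c₁ c₂ ν μ)
    (hunif : LayeredStable.LongUniform β q c₂) :
    (LayeredStable.sphericalWithDensity σ c₂ Set.univ ≠ 0 →
      (∀ p : ℝ, 0 < p → p < β → LayeredStable.absMoment μ p < ⊤) ∧
      (∀ p : ℝ, β ≤ p → LayeredStable.absMoment μ p = ⊤)) ∧
    (∀ p : ℝ, β ≤ p →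
      (LayeredStable.absMoment μ p < ⊤ ↔
        LayeredStable.sphericalWithDensity σ c₂ Set.univ = 0)) ∧
    (∀ θ : ℝ, 0 < θ →
      (LayeredStable.expMoment μ θ < ⊤ ↔
        LayeredStable.sphericalWithDensity σ c₂ Set.univ = 0)) := by
  have hβ := hμ.outer_pos
  have := hμ.law.1.1
  have hinf : LayeredStable.sphericalWithDensity σ c₂ Set.univ ≠ 0 →
      ∀ p : ℝ, β ≤ p → LayeredStable.absMoment μ p = ⊤ := fun hσ p hp =>
    LayeredStable.absMoment_eq_top_mono hβ hp (hμ.absMoment_outer_eq_top hunif hσ)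
  -- This serves both directions: with θ = 1 it gives finite power moments when σ₂ vanishes, and
  -- with p = β it rules out exponential moments otherwise.
  have hle : ∀ p θ : ℝ, β ≤ p → 0 < θ → LayeredStable.expMoment μ θ < ⊤ →
      LayeredStable.absMoment μ p < ⊤ := fun p θ hp hθ h =>
    (LayeredStable.absMoment_le_expMoment (hβ.trans_le hp) hθ μ).trans_lt
      (ENNReal.mul_lt_top ENNReal.ofReal_lt_top h)
  refine ⟨fun hσ => ⟨fun p hp hpβ => hμ.absMoment_lt_top hunif hp hpβ, hinf hσ⟩,
    fun p hp => ⟨fun h => ?_, fun hσ => hle p 1 hp one_pos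
      (hμ.expMoment_lt_top hunif hσ one_pos)⟩,
    fun θ hθ => ⟨fun h => ?_, fun hσ => hμ.expMoment_lt_top hunif hσ hθ⟩⟩
  · by_contra hσ
    exact h.ne (hinf hσ p hp)
  · by_contra hσ
    exact (hle β θ le_rfl hθ h).ne (hinf hσ β le_rfl)
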